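/- A linearized chord diagram of size $n$ is a partition of the points $1,\dots,2n$, placed in increasing order on a line, into $n$ pairs (chords). Two chords $\{a<c\}$ and $\{b<d\}$ cross if $a<b<c<d$ or $b<a<d<c$. A cut of a diagram is a partition of $\{1,\dots,2n\}$ into the two non-empty blocks $\{1,\dots,2n_1\}$ and $\{2n_1+1,\dots,2n\}$, $0<n_1<n$, such that no chord joins points of different blocks; its size is $\min\{n_1,n-n_1\}$, the number of chords on its smaller side. For $0\le m\le\binom n2$ let $Y_{n,m}$ be the largest size of a cut (with $Y_{n,m}=0$ if there is no cut) of a diagram chosen uniformly at random among all linearized chord diagrams of size $n$ with exactly $m$ crossings. If $m=O(n)$, then $Y_{n,m}$ is bounded in probability. That is, for every constant $C$ and every $\varepsilon>0$ there is an $A$, depending only on $C$ and $\varepsilon$, such that $$\mathrm{P}(Y_{n,m}\ge A)\le\varepsilon\qquad\text{for all } n\ge 0 \text{ and all } 0\le m\le\tbinom n2 \text{ with } m\le Cn.$$ -/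

import Mathlib

open MeasureTheory ProbabilityTheory

/-- A linearized chord diagram of size `n`: a pairing of the `2 n` points of `Fin (2 * n)`,
given as the fixed-point-free involution sending each point to its partner.
The points `1, …, 2 n` are here numbered `0, …, 2 n - 1`. -/
abbrev ChordDiagram (n : ℕ) : Type :=
  {f : Fin (2 * n) → Fin (2 * n) // (∀ i, f (f i) = i) ∧ ∀ i, f i ≠ i}

namespace ChordDiagram

/-- The number of crossings, i.e. of pairs of chords `{a, c}`, `{b, d}` with `a < b < c < d`.
Such a pair is listed once, by its two left endpoints `(a, b)`. -/
def crossings {n : ℕ} (D : ChordDiagram n) : ℕ :=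
  (Finset.univ.filter fun p : Fin (2 * n) × Fin (2 * n) =>
    p.1 < p.2 ∧ p.2 < D.1 p.1 ∧ D.1 p.1 < D.1 p.2).card

/-- `D.IsCut k`: the partition of the points into the (non-empty) blocks of the first `2 k` points
and of the remaining `2 (n - k)` points is a cut, i.e. no chord joins the two blocks. -/
def IsCut {n : ℕ} (D : ChordDiagram n) (k : ℕ) : Prop :=
  0 < k ∧ k < n ∧ ∀ i : Fin (2 * n), (i : ℕ) < 2 * k ↔ (D.1 i : ℕ) < 2 * k

instance {n : ℕ} (D : ChordDiagram n) : DecidablePred D.IsCut := fun k => by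
  unfold IsCut; infer_instance

/-- The maximum over all cuts of `min (k, n - k)`, the number of chords on the smaller side
(`0` if there is no cut). -/
def maxCut {n : ℕ} (D : ChordDiagram n) : ℕ :=
  ((Finset.range n).filter D.IsCut).sup fun k => min k (n - k)

end ChordDiagram

/-- The uniform distribution on the chord diagrams of size `n` with exactly `m` crossings. -/
noncomputable def uniformDiagram (n m : ℕ) : Measure (ChordDiagram n) :=
  uniformOn {D : ChordDiagram n | D.crossings = m}

/-! ### Closed intervals and insertion of blocks. -/

namespace ChordDiagram

open Finset

/-! Count diagrams by size (variable `x`) and crossings. A non-empty diagram is an irreducible core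
through the first point, of size `k` and without proper closed intervals, with an arbitrary diagram
inserted after each of its `2k` points. Crossings add up under insertion. Hence the series satisfies
`F = P(x F²)` with `P = 1 + I`, where `I` counts the cores, and Lagrange inversion gives `(2n+1) F_n
= ∑_j C(2n+1, j) [xⁿ] I^j` (`natCast_mul_gf`).

A diagram cut after `k` chords is a concatenation, counted by `F_k F_{n-k}`. Expanding both factors
in this way produces the products `C(2k+1, j) C(2(n-k)+1, i)`. Divided by `C(2n+2, i+j)`, such a
product is a hypergeometric point probability, of order `j^(-1/2)` at most
(`succ_mul_choose_mul_choose_le`). The Lagrange prefactors contribute a further `1/k`, and `k ≥ A`,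
`k ≥ j` give `j^(-1/2) / k ≤ A^(-1/4) j^(-5/4)`.

Now sum (`sum_coeff_gf_mul_gf_le`): over `k` the coefficients of `I^j` and `I^i` convolve to at most
`[xⁿ] I^(i+j)`, over `i` the Lagrange formula reassembles `(2n+1) F_n`, and over `j` the weights
converge. So a proportion `O(A^(-1/4))` of the diagrams has a cut of size at least `A`. All
inequalities hold coefficientwise in the crossing variable, so one `A` serves every `m`. -/

/-- `D.Closed a b`: no chord of `D` leaves the interval `[a, b)`. -/
def Closed {n : ℕ} (D : ChordDiagram n) (a b : ℕ) : Prop :=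
  ∀ i : Fin (2 * n), a ≤ (i : ℕ) → (i : ℕ) < b → a ≤ (D.1 i : ℕ) ∧ (D.1 i : ℕ) < b

/-- No non-empty closed interval starts at one of the points `1, …, p`. -/
def Clean {n : ℕ} (D : ChordDiagram n) (p : ℕ) : Prop :=
  ∀ a b, 1 ≤ a → a ≤ p → a < b → b ≤ 2 * n → ¬ D.Closed a b

/-- The points of a diagram of size `l + s`, split into an interval of `2 l` points starting
at `p` and the `2 s` remaining points. -/
def insertEquiv (l s p : ℕ) (hp : p ≤ 2 * s) : Fin (2 * l) ⊕ Fin (2 * s) ≃ Fin (2 * (l + s)) where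
  toFun := Sum.elim (fun y => ⟨p + y, by omega⟩)
    (fun x => ⟨if (x : ℕ) < p then x else x + 2 * l, by split <;> omega⟩)
  invFun z := if h : (z : ℕ) < p then Sum.inr ⟨z, by omega⟩
    else if h' : (z : ℕ) < p + 2 * l then Sum.inl ⟨z - p, by omega⟩
    else Sum.inr ⟨z - 2 * l, by omega⟩
  left_inv := by
    rintro (y | x)
    · have : ¬ (p + (y : ℕ) < p) := by omega
      simp [y.2]
    · by_cases h : (x : ℕ) < p
      · simp [h]
      · have h1 : ¬ ((x : ℕ) + 2 * l < p) := by omega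
        have h2 : ¬ ((x : ℕ) < p) := by omega
        simp [h1, h2]
  right_inv := by
    intro z
    by_cases h : (z : ℕ) < p
    · simp [h]
    · by_cases h' : (z : ℕ) < p + 2 * l
      · ext; simp [h, h']; omega
      · have : ¬ ((z : ℕ) - 2 * l < p) := by omega
        ext; simp [h, h', this]; omega

section insertion

variable {l s p : ℕ} (hp : p ≤ 2 * s)

@[simp] lemma insertEquiv_inl (y : Fin (2 * l)) :
    (insertEquiv l s p hp (Sum.inl y) : ℕ) = p + y := rfl

lemma insertEquiv_inr (x : Fin (2 * s)) :
    (insertEquiv l s p hp (Sum.inr x) : ℕ) = if (x : ℕ) < p then (x : ℕ) else x + 2 * l := rfl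

/-- The diagram obtained from `E` by inserting `B` as a block of consecutive points at `p`. -/
def insert (B : ChordDiagram l) (E : ChordDiagram s) : ChordDiagram (l + s) :=
  ⟨fun z => insertEquiv l s p hp (Sum.map B.1 E.1 ((insertEquiv l s p hp).symm z)), by
    constructor
    · intro z
      obtain ⟨u, rfl⟩ := (insertEquiv l s p hp).surjective z
      rcases u with y | x
      · simp [B.2.1]
      · simp [E.2.1]
    · intro z
      obtain ⟨u, rfl⟩ := (insertEquiv l s p hp).surjective z
      rcases u with y | x
      · simp [B.2.2]
      · simp [E.2.2]⟩

@[simp] lemma insert_inl (B : ChordDiagram l) (E : ChordDiagram s) (y : Fin (2 * l)) :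
    (insert hp B E).1 (insertEquiv l s p hp (Sum.inl y)) =
      insertEquiv l s p hp (Sum.inl (B.1 y)) := by simp [insert]

@[simp] lemma insert_inr (B : ChordDiagram l) (E : ChordDiagram s) (x : Fin (2 * s)) :
    (insert hp B E).1 (insertEquiv l s p hp (Sum.inr x)) =
      insertEquiv l s p hp (Sum.inr (E.1 x)) := by simp [insert]

lemma insert_injective {B B' : ChordDiagram l} {E E' : ChordDiagram s}
    (h : insert hp B E = insert hp B' E') : B = B' ∧ E = E' := by
  constructor
  · apply Subtype.ext
    funext y
    have := insert_inl hp B E y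
    rw [h, insert_inl] at this
    simpa using this.symm
  · apply Subtype.ext
    funext y
    have := insert_inr hp B E y
    rw [h, insert_inr] at this
    simpa using this.symm

lemma closed_insert (B : ChordDiagram l) (E : ChordDiagram s) :
    (insert hp B E).Closed p (p + 2 * l) := by
  intro z h1 h2
  obtain ⟨u, rfl⟩ := (insertEquiv l s p hp).surjective z
  rcases u with y | x
  · simp only [insert_inl, insertEquiv_inl]
    omega
  · rw [insertEquiv_inr] at h1 h2
    split_ifs at h1 h2 <;> omega

lemma exists_insert_eq (D : ChordDiagram (l + s)) (hD : D.Closed p (p + 2 * l)) :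
    ∃ B E, insert hp B E = D := by
  set e := insertEquiv l s p hp with he
  have h1 : ∀ y : Fin (2 * l), ∃ y', D.1 (e (Sum.inl y)) = e (Sum.inl y') := by
    intro y
    have := hD (e (Sum.inl y)) (by simp [he]) (by simp [he])
    obtain ⟨u, hu⟩ := e.surjective (D.1 (e (Sum.inl y)))
    rcases u with y' | x
    · exact ⟨y', hu.symm⟩
    · rw [← hu, he, insertEquiv_inr] at this
      split_ifs at this <;> omega
  -- The complement is closed too: a partner inside the block would send its own partner back into
  -- the block.
  have h2 : ∀ x : Fin (2 * s), ∃ x', D.1 (e (Sum.inr x)) = e (Sum.inr x') := by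
    intro x
    obtain ⟨u, hu⟩ := e.surjective (D.1 (e (Sum.inr x)))
    rcases u with y | x'
    · obtain ⟨y', hy'⟩ := h1 y
      rw [hu, D.2.1] at hy'
      simp at hy'
    · exact ⟨x', hu.symm⟩
  choose f hf using h1
  choose g hg using h2
  refine ⟨⟨f, fun y => ?_, fun y hy => ?_⟩, ⟨g, fun x => ?_, fun x hx => ?_⟩, ?_⟩
  · have := D.2.1 (e (Sum.inl y))
    rw [hf, hf] at this
    simpa using this
  · exact D.2.2 (e (Sum.inl y)) (by rw [hf, hy])
  · have := D.2.1 (e (Sum.inr x))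
    rw [hg, hg] at this
    simpa using this
  · exact D.2.2 (e (Sum.inr x)) (by rw [hg, hx])
  · apply Subtype.ext
    funext z
    obtain ⟨u, rfl⟩ := e.surjective z
    rcases u with y | x
    · exact (insert_inl hp _ _ y).trans (hf y).symm
    · exact (insert_inr hp _ _ x).trans (hg x).symm

lemma crossings_eq_sum {n : ℕ} (D : ChordDiagram n) :
    D.crossings = ∑ i, ∑ j, if i < j ∧ j < D.1 i ∧ D.1 i < D.1 j then 1 else 0 := by
  rw [crossings, Finset.card_filter, Fintype.sum_prod_type]

lemma insertEquiv_inr_lt_iff (x x' : Fin (2 * s)) :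
    insertEquiv l s p hp (Sum.inr x) < insertEquiv l s p hp (Sum.inr x') ↔ x < x' := by
  rw [Fin.lt_def, Fin.lt_def, insertEquiv_inr, insertEquiv_inr]
  split_ifs <;> omega

lemma insertEquiv_inl_lt_iff (x x' : Fin (2 * l)) :
    insertEquiv l s p hp (Sum.inl x) < insertEquiv l s p hp (Sum.inl x') ↔ x < x' := by
  rw [Fin.lt_def, Fin.lt_def, insertEquiv_inl, insertEquiv_inl]
  omega

/-- The block is an interval, so no chord of `E` separates its points and the two mixed sums vanish.
-/
lemma crossings_insert (B : ChordDiagram l) (E : ChordDiagram s) :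
    (insert hp B E).crossings = B.crossings + E.crossings := by
  simp only [crossings_eq_sum]
  rw [← (insertEquiv l s p hp).sum_comp, Fintype.sum_sum_type]
  congr 1
  · refine Finset.sum_congr rfl fun y _ => ?_
    rw [← (insertEquiv l s p hp).sum_comp, Fintype.sum_sum_type]
    simp only [insert_inl, insert_inr, insertEquiv_inl_lt_iff]
    rw [add_eq_left]
    refine Finset.sum_eq_zero fun x _ => if_neg ?_
    simp only [Fin.lt_def, insertEquiv_inl, insertEquiv_inr]
    split_ifs <;> omega
  · refine Finset.sum_congr rfl fun x _ => ?_
    rw [← (insertEquiv l s p hp).sum_comp, Fintype.sum_sum_type]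
    simp only [insert_inl, insert_inr, insertEquiv_inr_lt_iff]
    rw [add_eq_right]
    refine Finset.sum_eq_zero fun y _ => if_neg ?_
    simp only [Fin.lt_def, insertEquiv_inl, insertEquiv_inr]
    split_ifs <;> omega

lemma closed_of_closed_insert {B : ChordDiagram l} {E : ChordDiagram s} {a b : ℕ} (hap : a ≤ p)
    (h : (insert hp B E).Closed a b) (hb : p + 2 * l ≤ b) : E.Closed a (b - 2 * l) := by
  intro x h1 h2
  have := h (insertEquiv l s p hp (Sum.inr x))
  rw [insert_inr, insertEquiv_inr, insertEquiv_inr] at this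
  split_ifs at this <;> omega

lemma closed_of_closed_insert_of_le {B : ChordDiagram l} {E : ChordDiagram s} {a b : ℕ}
    (h : (insert hp B E).Closed a b) (hb : b ≤ p + 2 * l) (hap : a < p) :
    E.Closed a (min b p) := by
  intro x h1 h2
  have := h (insertEquiv l s p hp (Sum.inr x))
  rw [insert_inr, insertEquiv_inr, insertEquiv_inr] at this
  split_ifs at this <;> omega

lemma closed_insert_of_le {B : ChordDiagram l} {E : ChordDiagram s} {a b : ℕ}
    (h : E.Closed a b) (hb : b ≤ p) : (insert hp B E).Closed a b := by
  intro z h1 h2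
  obtain ⟨u, rfl⟩ := (insertEquiv l s p hp).surjective z
  rcases u with y | x
  · rw [insertEquiv_inl] at h1 h2
    omega
  · have := h x
    rw [insertEquiv_inr] at h1 h2
    rw [insert_inr, insertEquiv_inr]
    split_ifs at * <;> omega

lemma closed_insert_of_ge {B : ChordDiagram l} {E : ChordDiagram s} {a b : ℕ} (hap : a ≤ p)
    (h : E.Closed a b) (hb : p ≤ b) : (insert hp B E).Closed a (b + 2 * l) := by
  intro z h1 h2
  obtain ⟨u, rfl⟩ := (insertEquiv l s p hp).surjective z
  rcases u with y | x
  · rw [insert_inl, insertEquiv_inl]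
    omega
  · have := h x
    rw [insertEquiv_inr] at h1 h2
    rw [insert_inr, insertEquiv_inr]
    split_ifs at * <;> omega

end insertion

/-! ### Maximal closed intervals. -/

/-- `l` is the size of the largest closed interval of `D` starting at `p`. -/
def IsMaxAt {n : ℕ} (D : ChordDiagram n) (p l : ℕ) : Prop :=
  p + 2 * l ≤ 2 * n ∧ D.Closed p (p + 2 * l) ∧
    ∀ b, p + 2 * l < b → b ≤ 2 * n → ¬ D.Closed p b

lemma Closed.even {n : ℕ} {D : ChordDiagram n} {a b : ℕ} (h : D.Closed a b) (hb : b ≤ 2 * n) :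
    Even (b - a) := by
  -- Partners pair off inside the interval, so its length vanishes modulo 2.
  have key : ∑ i ∈ univ.filter (fun i : Fin (2 * n) => a ≤ (i : ℕ) ∧ (i : ℕ) < b), (1 : ZMod 2)
      = 0 := by
    refine Finset.sum_involution (fun i _ => D.1 i) (fun _ _ => by decide)
      (fun i _ _ => D.2.2 i) (fun i hi => ?_) (fun i _ => D.2.1 i)
    simp only [mem_filter, mem_univ, true_and] at hi ⊢
    exact h i hi.1 hi.2
  rw [Finset.sum_const, nsmul_eq_mul, mul_one, ZMod.natCast_eq_zero_iff_even] at key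
  have hc : (univ.filter (fun i : Fin (2 * n) => a ≤ (i : ℕ) ∧ (i : ℕ) < b)).card = b - a := by
    rw [← Nat.card_Ico a b, ← Finset.card_map Fin.valEmbedding]
    congr 1
    ext x
    simp only [mem_map, mem_filter, mem_univ, true_and, Fin.valEmbedding_apply, mem_Ico]
    constructor
    · rintro ⟨i, hi, rfl⟩
      exact hi
    · intro hx
      exact ⟨⟨x, by omega⟩, hx, rfl⟩
  rwa [hc] at key

lemma IsMaxAt.unique {n : ℕ} {D : ChordDiagram n} {p l l' : ℕ} (h : D.IsMaxAt p l)
    (h' : D.IsMaxAt p l') : l = l' := by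
  by_contra hne
  rcases Nat.lt_or_gt_of_ne hne with hl | hl
  · exact h.2.2 _ (by omega) h'.1 h'.2.1
  · exact h'.2.2 _ (by omega) h.1 h.2.1

lemma exists_isMaxAt {n : ℕ} (D : ChordDiagram n) {p : ℕ} (hp : p ≤ 2 * n) :
    ∃ l, D.IsMaxAt p l := by
  classical
  let P : ℕ → Prop := fun l => p + 2 * l ≤ 2 * n ∧ D.Closed p (p + 2 * l)
  have h0 : P 0 := ⟨by omega, fun i h1 h2 => by omega⟩
  have hs : P (Nat.findGreatest P n) := Nat.findGreatest_spec (Nat.zero_le n) h0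
  refine ⟨Nat.findGreatest P n, hs.1, hs.2, fun b hb hb' hc => ?_⟩
  obtain ⟨r, hr⟩ := hc.even hb'
  have hbr : b = p + 2 * r := by omega
  subst hbr
  have := Nat.le_findGreatest (P := P) (show r ≤ n by omega) ⟨hb', hc⟩
  omega

/-- Contracting the block turns an offending closed interval into a non-empty closed interval of
`E`, and re-inserting reverses this. Nothing is demanded of `B`, which is why the recursion for
`cleanGF` has the full `gf` as a factor. -/
lemma clean_insert_iff {l s p : ℕ} (hp : p + 1 ≤ 2 * s) (B : ChordDiagram l)
    (E : ChordDiagram s) :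
    (insert hp B E).Clean p ∧ (insert hp B E).IsMaxAt (p + 1) l ↔ E.Clean (p + 1) := by
  constructor
  · rintro ⟨h1, h2⟩ a b ha hap hab hb hE
    rcases Nat.lt_or_ge b (p + 1) with h | h
    · exact h1 a b ha (by omega) hab (by omega) (closed_insert_of_le hp hE (by omega))
    · have hc := closed_insert_of_ge hp (B := B) hap hE h
      rcases Nat.lt_or_ge a (p + 1) with h' | h'
      · exact h1 a _ ha (by omega) (by omega) (by omega) hc
      · obtain rfl : a = p + 1 := by omega
        exact h2.2.2 _ (by omega) (by omega) hc
  · intro h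
    refine ⟨fun a b ha hap hab hb hE => ?_, by omega, closed_insert hp B E, fun b hb hb' hE => ?_⟩
    · rcases le_total b (p + 1 + 2 * l) with h' | h'
      · exact h a _ ha (by omega) (by omega) (by omega)
          (closed_of_closed_insert_of_le hp hE h' (by omega))
      · exact h a _ ha (by omega) (by omega) (by omega)
          (closed_of_closed_insert hp (by omega) hE h')
    · exact h (p + 1) _ (by omega) le_rfl (by omega) (by omega)
        (closed_of_closed_insert hp le_rfl hE (by omega))

/-! ### Crossing generating functions and their recursion. -/

open Polynomial

open scoped Classical in
/-- The crossing generating function of the diagrams of size `n` that are clean up to `p`. -/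
noncomputable def cleanGF (p n : ℕ) : ℝ[X] :=
  ∑ D : ChordDiagram n, if D.Clean p then X ^ D.crossings else 0

/-- The crossing generating function of all diagrams of size `n`. -/
noncomputable def gf (n : ℕ) : ℝ[X] := ∑ D : ChordDiagram n, X ^ D.crossings

lemma cleanGF_zero (n : ℕ) : cleanGF 0 n = gf n := by
  refine Finset.sum_congr rfl fun D _ => if_pos ?_
  intro a b h1 h2
  omega

open scoped Classical in
lemma cleanGF_of_le {n p : ℕ} (h : 2 * n ≤ p) : cleanGF p n = cleanGF (2 * n) n := by
  refine Finset.sum_congr rfl fun D _ => ?_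
  have : D.Clean p ↔ D.Clean (2 * n) := by
    constructor
    · intro H a b h1 h2
      exact H a b h1 (by omega)
    · intro H a b h1 h2 h3 h4
      exact H a b h1 (by omega) h3 h4
  exact if_congr this rfl rfl

open scoped Classical in
/-- Summation over the diagrams with a closed interval of size `l` at `p`. -/
lemma sum_closed {l s p : ℕ} (hp : p ≤ 2 * s) (Q : ChordDiagram (l + s) → Prop) :
    ∑ D : ChordDiagram (l + s),
        (if D.Closed p (p + 2 * l) ∧ Q D then (X ^ D.crossings : ℝ[X]) else 0) =
      ∑ B : ChordDiagram l, ∑ E : ChordDiagram s,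
        if Q (insert hp B E) then X ^ B.crossings * X ^ E.crossings else 0 := by
  rw [← Fintype.sum_prod_type', ← Finset.sum_filter, ← Finset.sum_filter]
  symm
  refine Finset.sum_bij (fun x _ => insert hp x.1 x.2) ?_ ?_ ?_ ?_
  · rintro ⟨B, E⟩ h
    simp only [mem_filter, mem_univ, true_and] at h ⊢
    exact ⟨closed_insert hp B E, h⟩
  · rintro ⟨B, E⟩ _ ⟨B', E'⟩ _ h
    obtain ⟨rfl, rfl⟩ := insert_injective hp h
    rfl
  · intro D hD
    simp only [mem_filter, mem_univ, true_and] at hD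
    obtain ⟨B, E, rfl⟩ := exists_insert_eq hp D hD.1
    exact ⟨⟨B, E⟩, by simpa using hD.2, rfl⟩
  · rintro ⟨B, E⟩ _
    rw [crossings_insert, pow_add]

open scoped Classical in
lemma cleanGF_eq_sum {n p : ℕ} (hp : p + 1 ≤ 2 * n) :
    cleanGF p n = ∑ x ∈ antidiagonal n,
      if p + 1 ≤ 2 * x.2 then gf x.1 * cleanGF (p + 1) x.2 else 0 := by
  -- Each diagram has exactly one maximal closed interval at `p + 1`, possibly empty; sort by its
  -- size.
  have h1 : cleanGF p n = ∑ D : ChordDiagram n, ∑ x ∈ antidiagonal n,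
      if D.Clean p ∧ D.IsMaxAt (p + 1) x.1 then (X ^ D.crossings : ℝ[X]) else 0 := by
    refine Finset.sum_congr rfl fun D _ => ?_
    obtain ⟨l, hl⟩ := D.exists_isMaxAt hp
    have hln : p + 1 + 2 * l ≤ 2 * n := hl.1
    rw [Finset.sum_eq_single (l, n - l)]
    · simp [hl]
    · rintro ⟨l', s⟩ hx hne
      refine if_neg fun h => hne ?_
      obtain rfl := h.2.unique hl
      rw [HasAntidiagonal.mem_antidiagonal] at hx
      simp only at hx
      ext <;> simp; omega
    · intro h
      exact absurd (HasAntidiagonal.mem_antidiagonal.2 (by simp only; omega)) h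
  rw [h1, Finset.sum_comm]
  refine Finset.sum_congr rfl fun x hx => ?_
  obtain ⟨l, s⟩ := x
  rw [HasAntidiagonal.mem_antidiagonal] at hx
  simp only at hx ⊢
  subst hx
  split_ifs with h
  · have := sum_closed h (fun D : ChordDiagram (l + s) => D.Clean p ∧ D.IsMaxAt (p + 1) l)
    simp only [clean_insert_iff] at this
    rw [gf, cleanGF, Finset.sum_mul_sum]
    simp only [mul_ite, mul_zero]
    rw [← this]
    refine Finset.sum_congr rfl fun D _ => ?_
    congr 1
    simp only [eq_iff_iff]
    exact ⟨fun h => ⟨h.2.2.1, h⟩, fun h => h.2⟩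
  · refine Finset.sum_eq_zero fun D _ => if_neg fun hD => h ?_
    have := hD.2.1
    omega

open scoped Classical in
lemma sum_isCut {n k : ℕ} (hk : k ≤ n) :
    ∑ D : ChordDiagram n, (if D.Closed 0 (2 * k) then (X ^ D.crossings : ℝ[X]) else 0) =
      gf k * gf (n - k) := by
  obtain ⟨s, rfl⟩ := Nat.exists_eq_add_of_le hk
  rw [Nat.add_sub_cancel_left]
  have := sum_closed (Nat.zero_le (2 * s)) (fun D : ChordDiagram (k + s) => True)
  simp only [and_true, if_true, zero_add] at this
  rw [this, gf, gf, Finset.sum_mul_sum]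

end ChordDiagram

/-! ### Hypergeometric point probabilities. -/

section hypergeometric

lemma choose_mul_choose_step (a b x y : ℕ) (hx : x < a) (hy : 0 < y) (hyb : y ≤ b) :
    (a.choose (x + 1) * b.choose (y - 1) : ℝ) * ((x + 1) * (b - y + 1)) =
      a.choose x * b.choose y * ((a - x) * y) := by
  obtain ⟨y, rfl⟩ := Nat.exists_eq_succ_of_ne_zero hy.ne'
  have h1 := Nat.choose_succ_right_eq a x
  have h2 := Nat.choose_succ_right_eq b y
  have h1' : (a.choose (x + 1) : ℝ) * (x + 1) = a.choose x * (a - x) := by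
    rw [← Nat.cast_sub hx.le]; exact_mod_cast h1
  have h2' : (b.choose (y + 1) : ℝ) * (y + 1) = b.choose y * (b - y) := by
    rw [← Nat.cast_sub (by omega : y ≤ b)]; exact_mod_cast h2
  simp only [Nat.succ_eq_add_one, Nat.add_sub_cancel]
  push_cast
  linear_combination (b.choose y : ℝ) * (b - y) * h1' - (a.choose x * (a - x) : ℝ) * h2'

/-- Bernoulli's inequality, `(1 - δ)^t ≥ 1 - t δ`. -/
lemma half_le_of_step {g : ℕ → ℝ} {T : ℕ} {δ : ℝ} (hδ : 0 ≤ δ) (hT : T * δ ≤ 1 / 2)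
    (h0 : 0 ≤ g 0) (hg : ∀ t < T, (1 - δ) * g t ≤ g (t + 1)) :
    ∀ t ≤ T, g 0 / 2 ≤ g t := by
  have key : ∀ t ≤ T, (1 - t * δ) * g 0 ≤ g t := by
    intro t
    induction t with
    | zero => intro; simp
    | succ t ih =>
      intro ht
      have h1 := ih (by omega)
      have h2 := hg t (by omega)
      have htT : ((t : ℝ) + 1) ≤ T := by exact_mod_cast ht
      have hδ1 : δ ≤ 1 := by nlinarith [(Nat.cast_nonneg t : (0 : ℝ) ≤ t)]
      have h3 := mul_le_mul_of_nonneg_left h1 (sub_nonneg.2 hδ1)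
      have h4 : 0 ≤ (t : ℝ) * δ * δ * g 0 := by positivity
      push_cast
      nlinarith
  intro t ht
  have h1 := key t ht
  have h2 : (t : ℝ) * δ ≤ T * δ := mul_le_mul_of_nonneg_right (by exact_mod_cast ht) hδ
  nlinarith

lemma sum_choose_mul_choose_le (a b m : ℕ) (S : Finset (ℕ × ℕ))
    (hS : ∀ x ∈ S, x.1 + x.2 = m) :
    ∑ x ∈ S, (a.choose x.1 * b.choose x.2 : ℝ) ≤ (a + b).choose m := by
  rw [Nat.add_choose_eq]
  push_cast
  exact Finset.sum_le_sum_of_subset_of_nonneg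
    (fun x hx => Finset.HasAntidiagonal.mem_antidiagonal.2 (hS x hx)) (fun _ _ _ => by positivity)

variable {a b j i T : ℕ}

/-- By `hu` the ratio of consecutive weights is at least 1 at the start. After `t` steps each of its
four factors has changed by a relative amount of at most `x = t / j`, because `a - j`, `i` and `b -
i + 1` are all at least `j`. -/
lemma up_step (hj : 1 ≤ j) (ha : 2 * j + 1 ≤ a) (hb : i + j + 1 ≤ b) (hij : j < i)
    (hT : 10 * T ^ 2 ≤ j)
    (hu : ((j : ℝ) + 1) * (b - i + 1) ≤ (a - j) * i) {t : ℕ} (ht : t < T) :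
    (1 - 5 * T / j : ℝ) * (a.choose (j + t) * b.choose (i - t)) ≤
      a.choose (j + (t + 1)) * b.choose (i - (t + 1)) := by
  have htj : t < j := by nlinarith
  have hjR : (1 : ℝ) ≤ j := by exact_mod_cast hj
  have haR : (2 * j + 1 : ℝ) ≤ a := by exact_mod_cast ha
  have hbR : (i + j + 1 : ℝ) ≤ b := by exact_mod_cast hb
  have hijR : (j + 1 : ℝ) ≤ i := by exact_mod_cast hij
  have htT : (t + 1 : ℝ) ≤ T := by exact_mod_cast ht
  have htjR : (t + 1 : ℝ) ≤ j := by exact_mod_cast htj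
  have ht0 : (0 : ℝ) ≤ t := Nat.cast_nonneg t
  have hstep := choose_mul_choose_step a b (j + t) (i - t) (by omega) (by omega) (by omega)
  rw [show i - t - 1 = i - (t + 1) by omega, Nat.cast_sub (by omega : t ≤ i)] at hstep
  push_cast at hstep
  set h := (a.choose (j + t) * b.choose (i - t) : ℝ) with hh
  have hh0 : 0 ≤ h := by positivity
  set h' := (a.choose (j + (t + 1)) * b.choose (i - (t + 1)) : ℝ) with hh'
  rw [show j + t + 1 = j + (t + 1) by ring, ← hh'] at hstep
  set x : ℝ := t / j with hx
  have hx0 : 0 ≤ x := by positivity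
  have hx1 : x ≤ 1 := by rw [hx, div_le_one (by linarith)]; linarith
  have hxj : x * j = t := by rw [hx]; field_simp
  have hxT : 5 * x ≤ 5 * T / j := by
    rw [hx, ← mul_div_assoc]
    gcongr
  have p1 := mul_le_mul_of_nonneg_left (show (j : ℝ) ≤ a - j by linarith) hx0
  have p2 := mul_le_mul_of_nonneg_left (show (j : ℝ) ≤ i by linarith) hx0
  have p3 := mul_le_mul_of_nonneg_left (show (j : ℝ) ≤ b - i + 1 by linarith) hx0
  have e1 : (1 - x) * (a - j) ≤ a - (j + t) := by linarith
  have e2 : (1 - x) * i ≤ i - t := by linarith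
  have e3 : ((j : ℝ) + t + 1) ≤ (1 + x) * (j + 1) := by linarith
  have e4 : ((b : ℝ) - (i - t) + 1) ≤ (1 + x) * (b - i + 1) := by linarith
  have hD : 0 < ((j : ℝ) + t + 1) * (b - (i - t) + 1) := by
    apply mul_pos <;> linarith
  have hr : (1 - 5 * T / j) * (((j : ℝ) + t + 1) * (b - (i - t) + 1)) ≤
      (a - (j + t)) * (i - t) := by
    have f1 : (1 - x) * (a - j) * ((1 - x) * i) ≤ (a - (j + t)) * (i - t) := by
      apply mul_le_mul e1 e2 _ (by linarith)
      exact mul_nonneg (by linarith) (by linarith)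
    have f2 : ((j : ℝ) + t + 1) * (b - (i - t) + 1) ≤
        (1 + x) * (j + 1) * ((1 + x) * (b - i + 1)) :=
      mul_le_mul e3 e4 (by linarith) (by positivity)
    have f3 : (1 - 5 * T / j) * (((j : ℝ) + t + 1) * (b - (i - t) + 1)) ≤
        (1 - 5 * x) * (((j : ℝ) + t + 1) * (b - (i - t) + 1)) :=
      mul_le_mul_of_nonneg_right (by linarith) hD.le
    refine f3.trans ?_
    refine le_trans ?_ f1
    by_cases h5 : 1 - 5 * x ≤ 0
    · refine (mul_nonpos_of_nonpos_of_nonneg h5 hD.le).trans ?_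
      exact mul_nonneg (mul_nonneg (by linarith) (by linarith))
        (mul_nonneg (by linarith) (by linarith))
    · push Not at h5
      refine (mul_le_mul_of_nonneg_left f2 h5.le).trans ?_
      have g1 : (1 - 5 * x) * (1 + x) ^ 2 ≤ (1 - x) ^ 2 := by 
        linarith [pow_nonneg hx0 3, sq_nonneg x]
      have g2 : 0 ≤ ((j : ℝ) + 1) * (b - i + 1) := mul_nonneg (by linarith) (by linarith)
      calc (1 - 5 * x) * ((1 + x) * (j + 1) * ((1 + x) * (b - i + 1)))
          = ((1 - 5 * x) * (1 + x) ^ 2) * ((j + 1) * (b - i + 1)) := by ring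
        _ ≤ (1 - x) ^ 2 * ((j + 1) * (b - i + 1)) := mul_le_mul_of_nonneg_right g1 g2
        _ ≤ (1 - x) ^ 2 * ((a - j) * i) := mul_le_mul_of_nonneg_left hu (sq_nonneg _)
        _ = _ := by ring
  have : (1 - 5 * T / j : ℝ) * h * (((j : ℝ) + t + 1) * (b - (i - t) + 1)) ≤
      h' * (((j : ℝ) + t + 1) * (b - (i - t) + 1)) := by
    rw [hstep, mul_comm _ h, mul_assoc]
    exact mul_le_mul_of_nonneg_left hr hh0
  exact le_of_mul_le_mul_right this hD

/-- The mirror image of `up_step`, except that `i` may now be small compared with `j`. -/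
lemma down_step (hj : 1 ≤ j) (hab : a ≤ b) (ha : 2 * j + 1 ≤ a) (hb : i + j + 1 ≤ b)
    (hT : 10 * T ^ 2 ≤ j)
    (hu : ((a : ℝ) - j) * i ≤ (j + 1) * (b - i + 1)) {t : ℕ} (ht : t < T) :
    (1 - 5 * T / j : ℝ) * (a.choose (j - t) * b.choose (i + t)) ≤
      a.choose (j - (t + 1)) * b.choose (i + (t + 1)) := by
  have h10 : 10 * (t + 1) ≤ j := by nlinarith
  have hjR : (1 : ℝ) ≤ j := by exact_mod_cast hj
  have haR : (2 * j + 1 : ℝ) ≤ a := by exact_mod_cast ha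
  have habR : (a : ℝ) ≤ b := by exact_mod_cast hab
  have hbR : (i + j + 1 : ℝ) ≤ b := by exact_mod_cast hb
  have htT : (t + 1 : ℝ) ≤ T := by exact_mod_cast ht
  have htjR : 10 * (t + 1 : ℝ) ≤ j := by exact_mod_cast h10
  have ht0 : (0 : ℝ) ≤ t := Nat.cast_nonneg t
  have hi0 : (0 : ℝ) ≤ i := Nat.cast_nonneg i
  have hstep := choose_mul_choose_step a b (j - (t + 1)) (i + (t + 1)) (by omega) (by omega)
    (by omega)
  rw [show j - (t + 1) + 1 = j - t by omega, show i + (t + 1) - 1 = i + t by omega,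
    Nat.cast_sub (by omega : t + 1 ≤ j)] at hstep
  push_cast at hstep
  set h := (a.choose (j - t) * b.choose (i + t) : ℝ) with hh
  have hh0 : 0 ≤ h := by positivity
  set h' := (a.choose (j - (t + 1)) * b.choose (i + (t + 1)) : ℝ) with hh'
  set x : ℝ := (t + 1) / j with hx
  have hx0 : 0 ≤ x := by positivity
  have hxj : x * j = t + 1 := by rw [hx]; field_simp
  have hx1 : 10 * x ≤ 1 := by nlinarith
  have hxT : 5 * x ≤ 5 * T / j := by
    rw [hx, ← mul_div_assoc]
    gcongr
  have hD : 0 < ((a : ℝ) - (j - (t + 1))) * (i + (t + 1)) := by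
    apply mul_pos <;> linarith
  have hr : (1 - 5 * T / j) * (((a : ℝ) - (j - (t + 1))) * (i + (t + 1))) ≤
      (j - (t + 1) + 1) * (b - (i + (t + 1)) + 1) := by
    have f3 : (1 - 5 * T / j) * (((a : ℝ) - (j - (t + 1))) * (i + (t + 1))) ≤
        (1 - 5 * x) * (((a : ℝ) - (j - (t + 1))) * (i + (t + 1))) :=
      mul_le_mul_of_nonneg_right (by linarith) hD.le
    refine f3.trans ?_
    -- In the first case `a ≤ b` alone makes the ratio at least 1; in the second `i ≥ j - 2t ≥
    -- 4j/5`, so relative errors are controlled again.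
    rcases Nat.lt_or_ge (i + t) (j - t) with hlt | hge
    · have hlt' : (i : ℝ) + t + 1 ≤ j - t := by
        rw [← Nat.cast_sub (by omega : t ≤ j)]
        exact_mod_cast hlt
      have : ((a : ℝ) - (j - (t + 1))) * (i + (t + 1)) ≤
          (j - (t + 1) + 1) * (b - (i + (t + 1)) + 1) := by
        rw [mul_comm]
        apply mul_le_mul <;> linarith
      refine le_trans ?_ this
      exact mul_le_of_le_one_left hD.le (by linarith)
    · have hge' : (j : ℝ) - t ≤ i + t := by
        rw [← Nat.cast_sub (by omega : t ≤ j)]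
        exact_mod_cast hge
      have p1 := mul_le_mul_of_nonneg_left (show (j : ℝ) ≤ a - j by linarith) hx0
      have p2 := mul_le_mul_of_nonneg_left (show (4 / 5 * j : ℝ) ≤ i by linarith) hx0
      have p3 := mul_le_mul_of_nonneg_left (show (j : ℝ) ≤ b - i + 1 by linarith) hx0
      have e1 : ((a : ℝ) - (j - (t + 1))) ≤ (1 + x) * (a - j) := by linarith
      have e2 : ((i : ℝ) + (t + 1)) ≤ (1 + 5 / 4 * x) * i := by linarith
      have e3 : (1 - x) * ((j : ℝ) + 1) ≤ j - (t + 1) + 1 := by linarith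
      have e4 : (1 - x) * ((b : ℝ) - i + 1) ≤ b - (i + (t + 1)) + 1 := by linarith
      have f1 : (1 - x) * ((j : ℝ) + 1) * ((1 - x) * (b - i + 1)) ≤
          (j - (t + 1) + 1) * (b - (i + (t + 1)) + 1) := by
        apply mul_le_mul e3 e4 _ (by linarith)
        exact mul_nonneg (by linarith) (by linarith)
      have f2 : ((a : ℝ) - (j - (t + 1))) * (i + (t + 1)) ≤
          (1 + x) * (a - j) * ((1 + 5 / 4 * x) * i) :=
        mul_le_mul e1 e2 (by linarith) (mul_nonneg (by linarith) (by linarith))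
      refine le_trans ?_ f1
      refine (mul_le_mul_of_nonneg_left f2 (by linarith)).trans ?_
      have g1 : (1 - 5 * x) * ((1 + x) * (1 + 5 / 4 * x)) ≤ (1 - x) ^ 2 := by
        linarith [pow_nonneg hx0 3, sq_nonneg x]
      have g2 : 0 ≤ ((a : ℝ) - j) * i := mul_nonneg (by linarith) (by linarith)
      calc (1 - 5 * x) * ((1 + x) * (a - j) * ((1 + 5 / 4 * x) * i))
          = ((1 - 5 * x) * ((1 + x) * (1 + 5 / 4 * x))) * ((a - j) * i) := by ring
        _ ≤ (1 - x) ^ 2 * ((a - j) * i) := mul_le_mul_of_nonneg_right g1 g2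
        _ ≤ (1 - x) ^ 2 * ((j + 1) * (b - i + 1)) := mul_le_mul_of_nonneg_left hu (sq_nonneg _)
        _ = _ := by ring
  have : (1 - 5 * T / j : ℝ) * h * (((a : ℝ) - (j - (t + 1))) * (i + (t + 1))) ≤
      h' * (((a : ℝ) - (j - (t + 1))) * (i + (t + 1))) := by
    rw [← hstep, mul_comm _ h, mul_assoc]
    exact mul_le_mul_of_nonneg_left hr hh0
  exact le_of_mul_le_mul_right this hD

/-- A point probability of a hypergeometric distribution at `j` is `O (j ^ (-1/2))`. -/
lemma succ_mul_choose_mul_choose_le (hj : 1 ≤ j) (hab : a ≤ b) (ha : 2 * j + 1 ≤ a)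
    (hb : i + j + 1 ≤ b) (hT : 10 * T ^ 2 ≤ j) :
    ((T : ℝ) + 1) * (a.choose j * b.choose i) ≤ 2 * (a + b).choose (i + j) := by
  have hjR : (1 : ℝ) ≤ j := by exact_mod_cast hj
  have hδ : (0 : ℝ) ≤ 5 * T / j := by positivity
  have hTδ : (T : ℝ) * (5 * T / j) ≤ 1 / 2 := by
    rw [← mul_div_assoc, div_le_iff₀ (by linarith)]
    have : (10 * T ^ 2 : ℝ) ≤ j := by exact_mod_cast hT
    linarith
  have hTj : T ≤ j := by nlinarith
  -- A walk `φ` from `(j, i)` meets `T + 1` distinct Vandermonde terms, each at least half the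
  -- first; their sum is at most the full binomial coefficient. The walk goes in the direction in
  -- which the weights initially do not decrease.
  have main : ∀ φ : ℕ → ℕ × ℕ, Set.InjOn φ (Finset.range (T + 1)) →
      (∀ t ≤ T, (φ t).1 + (φ t).2 = i + j) → φ 0 = (j, i) →
      (∀ t < T, (1 - 5 * T / j : ℝ) * (a.choose (φ t).1 * b.choose (φ t).2) ≤
        a.choose (φ (t + 1)).1 * b.choose (φ (t + 1)).2) →
      ((T : ℝ) + 1) * (a.choose j * b.choose i) ≤ 2 * (a + b).choose (i + j) := by
    intro φ hinj hsum h0 hst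
    have h1 := half_le_of_step (g := fun t => (a.choose (φ t).1 * b.choose (φ t).2 : ℝ)) hδ hTδ
      (by positivity) hst
    have h2 := sum_choose_mul_choose_le a b (i + j) ((Finset.range (T + 1)).image φ) (by
      intro x hx
      obtain ⟨t, ht, rfl⟩ := Finset.mem_image.1 hx
      exact hsum t (by simpa [Nat.lt_succ_iff] using ht))
    rw [Finset.sum_image hinj] at h2
    have h3 := Finset.card_nsmul_le_sum (Finset.range (T + 1))
      (fun t => (a.choose (φ t).1 * b.choose (φ t).2 : ℝ)) _
      (fun t ht => h1 t (by simpa [Nat.lt_succ_iff] using ht))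
    rw [Finset.card_range, nsmul_eq_mul] at h3
    simp only [h0] at h3
    push_cast at h3
    linarith
  rcases le_total (((j : ℝ) + 1) * (b - i + 1)) ((a - j) * i) with hu | hu
  · have hij : j < i := by
      by_contra hle
      have hbR : (i + j + 1 : ℝ) ≤ b := by exact_mod_cast hb
      have haR : (2 * j + 1 : ℝ) ≤ a := by exact_mod_cast ha
      have habR : (a : ℝ) ≤ b := by exact_mod_cast hab
      have hleR : (i : ℝ) ≤ j := by exact_mod_cast (not_lt.1 hle)
      have hi0 : (0 : ℝ) ≤ i := Nat.cast_nonneg i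
      have : ((a : ℝ) - j) * i ≤ (b - i + 1) * j := by
        apply mul_le_mul <;> linarith
      nlinarith
    refine main (fun t => (j + t, i - t)) (fun t _ t' _ h => ?_) (fun t ht => ?_) rfl
      (fun t ht => up_step hj ha hb hij hT hu ht)
    · simp only [Prod.mk.injEq] at h
      omega
    · simp only
      omega
  · refine main (fun t => (j - t, i + t)) (fun t _ t' _ h => ?_) (fun t ht => ?_) rfl
      (fun t ht => down_step hj hab ha hb hT hu ht)
    · simp only [Prod.mk.injEq] at h
      omega
    · simp only
      omega

end hypergeometric

/-! ### Lagrange inversion. -/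

section lagrange

open PowerSeries Finset

variable {R : Type*} [CommRing R]

/-- Compare coefficients in `x (P^(N+1))' = (N+1) P^N · x P'`. -/
lemma natCast_mul_coeff_pow (P : R⟦X⟧) (N n : ℕ) :
    ∑ x ∈ HasAntidiagonal.antidiagonal n,
      (N + 1 : R) * (x.1 * coeff x.1 P * coeff x.2 (P ^ N)) = n * coeff n (P ^ (N + 1)) := by
  have hX : ∀ (Q : R⟦X⟧) (k : ℕ), coeff k (X * derivative R Q) = k * coeff k Q := by
    intro Q k
    cases k with
    | zero => simp
    | succ k =>
      rw [coeff_succ_X_mul, coeff_derivative]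
      push_cast
      ring
  rw [← hX, Derivation.leibniz_pow, Nat.add_sub_cancel]
  have : (X : R⟦X⟧) * ((N + 1) • (P ^ N) • derivative R P) =
      ((N + 1 : ℕ) : R⟦X⟧) * ((X * derivative R P) * P ^ N) := by
    simp only [nsmul_eq_mul, smul_eq_mul]
    ring
  rw [this, ← Finset.mul_sum, ← nsmul_eq_mul, map_nsmul, coeff_mul, nsmul_eq_mul]
  simp only [hX]
  push_cast
  rfl

/-- Lagrange inversion for `F = Φ (X F ^ 2)`. -/
lemma natCast_mul_coeff_pow_of_functional_eq [IsDomain R] [CharZero R] {F P : R⟦X⟧}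
    (hF : ∀ n, coeff n F = ∑ k ∈ range (n + 1), coeff k P * coeff (n - k) (F ^ (2 * k)))
    (h0 : coeff 0 P = 1) (n j : ℕ) :
    ((2 * n + j : ℕ) : R) * coeff n (F ^ j) = j * coeff n (P ^ (2 * n + j)) := by
  have hFj : ∀ n j, coeff n (F ^ (j + 1)) =
      ∑ x ∈ HasAntidiagonal.antidiagonal n, coeff x.1 P * coeff x.2 (F ^ (2 * x.1 + j)) := by
    intro n j
    -- Up to degree `n`, `F` agrees with a finite truncation of `P(x F²)`, so no composition of
    -- series is needed.
    have hle : ∀ i ≤ n, coeff i F =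
        coeff i (∑ k ∈ range (n + 1), PowerSeries.C (coeff k P) * (X ^ k * F ^ (2 * k))) := by
      intro i hi
      rw [hF, map_sum]
      simp only [coeff_C_mul, coeff_X_pow_mul']
      rw [← Finset.sum_subset (Finset.range_mono (Nat.succ_le_succ hi))]
      · refine Finset.sum_congr rfl fun k hk => ?_
        rw [if_pos (by simpa [Nat.lt_succ_iff] using hk)]
      · intro k _ hk
        rw [if_neg (by simpa [Nat.lt_succ_iff] using hk), mul_zero]
    have : coeff n (F ^ (j + 1)) = coeff n
        ((∑ k ∈ range (n + 1), PowerSeries.C (coeff k P) * (X ^ k * F ^ (2 * k))) * F ^ j) := by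
      rw [pow_succ', coeff_mul, coeff_mul]
      refine Finset.sum_congr rfl fun x hx => ?_
      rw [hle x.1 (by rw [HasAntidiagonal.mem_antidiagonal] at hx; omega)]
    rw [this, Finset.sum_mul, map_sum, Finset.Nat.sum_antidiagonal_eq_sum_range_succ_mk]
    refine Finset.sum_congr rfl fun k hk => ?_
    rw [mul_assoc, mul_assoc, ← pow_add, coeff_C_mul, coeff_X_pow_mul',
      if_pos (by simpa [Nat.lt_succ_iff] using hk)]
  -- Splitting off one factor `F` by `hFj` turns `(n, j+1)` into pairs `(n-k, 2k+j)`, all with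
  -- `2(n-k) + (2k+j) = M`.
  induction hM : 2 * n + j generalizing n j with
  | zero =>
    obtain rfl : n = 0 := by omega
    obtain rfl : j = 0 := by omega
    simp
  | succ M ih =>
    cases j with
    | zero =>
      rw [pow_zero, coeff_one, if_neg (by omega)]
      simp
    | succ j =>
      rcases Nat.eq_zero_or_pos M with rfl | hMpos
      · obtain rfl : n = 0 := by omega
        obtain rfl : j = 0 := by omega
        simp [hF 0, h0]
      · have h1 : (M : R) * coeff n (F ^ (j + 1)) =
            ∑ x ∈ HasAntidiagonal.antidiagonal n,
              ((j : R) * (coeff x.1 P * coeff x.2 (P ^ M)) +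
                2 * (x.1 * coeff x.1 P * coeff x.2 (P ^ M))) := by
          rw [hFj, Finset.mul_sum]
          refine Finset.sum_congr rfl fun x hx => ?_
          rw [HasAntidiagonal.mem_antidiagonal] at hx
          have := ih x.2 (2 * x.1 + j) (by omega)
          rw [mul_left_comm, this]
          push_cast
          ring
        have h2 := natCast_mul_coeff_pow P M n
        rw [← Finset.mul_sum] at h2
        rw [Finset.sum_add_distrib, ← Finset.mul_sum, ← Finset.mul_sum, ← coeff_mul,
          ← pow_succ'] at h1
        have hj : (j : R) = M - 2 * n := by
          rw [eq_sub_iff_add_eq]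
          exact_mod_cast (by omega : j + 2 * n = M)
        have hM0 : (M : R) ≠ 0 := by exact_mod_cast hMpos.ne'
        apply mul_left_cancel₀ hM0
        push_cast
        rw [hj] at h1 ⊢
        linear_combination (M + 1 : R) * h1 + 2 * h2

lemma coeff_one_add_pow (Q : R⟦X⟧) (hQ : coeff 0 Q = 0) (N : ℕ) {n K : ℕ} (hK : n < K) :
    coeff n ((1 + Q) ^ N) = ∑ j ∈ range K, (N.choose j : R) * coeff n (Q ^ j) := by
  have hz : ∀ j, n < j → coeff n (Q ^ j) = 0 := fun j hj =>
    X_pow_dvd_iff.1 (pow_dvd_pow_of_dvd (X_dvd_iff.2 (by simpa using hQ)) j) n hj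
  have hb : coeff n ((1 + Q) ^ N) = ∑ j ∈ range (N + 1), (N.choose j : R) * coeff n (Q ^ j) := by
    rw [add_comm, add_pow, map_sum]
    refine Finset.sum_congr rfl fun j _ => ?_
    rw [one_pow, mul_one, mul_comm, ← nsmul_eq_mul, map_nsmul, nsmul_eq_mul]
  rw [hb]
  rcases le_total (N + 1) K with h | h
  · refine Finset.sum_subset (Finset.range_mono h) fun j _ hj => ?_
    rw [Nat.choose_eq_zero_of_lt (by simpa using hj), Nat.cast_zero, zero_mul]
  · refine (Finset.sum_subset (Finset.range_mono h) fun j _ hj => ?_).symm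
    rw [hz j (by simp at hj; omega), mul_zero]

end lagrange

/-! ### The core decomposition and the cycle lemma. -/

namespace ChordDiagram

open Finset

/-- The generating function of all diagrams by size and crossings. -/
noncomputable def diagramSeries : PowerSeries (Polynomial ℝ) := PowerSeries.mk gf

/-- The generating function of the non-empty diagrams without proper closed intervals. -/
noncomputable def irredSeries : PowerSeries (Polynomial ℝ) :=
  PowerSeries.mk fun k => if k = 0 then 0 else cleanGF (2 * k) k

lemma gf_zero : gf 0 = 1 := by
  have : ∀ D : ChordDiagram 0, D.crossings = 0 := by
    intro D
    rw [crossings, Finset.card_eq_zero, Finset.filter_eq_empty_iff]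
    intro x
    exact x.1.elim0
  have hU : Fintype.card (ChordDiagram 0) = 1 := by decide
  simp [gf, this, hU]

-- A core of size `k` has slots `1, …, 2k`. Cleanness up to `p` leaves the first `p` of them empty,
-- and each of the other `2k - p` carries an arbitrary diagram. The truncated subtraction is right:
-- for `2k ≤ p` only the bare core remains. The induction fills slots one at a time.
open PowerSeries in
lemma cleanGF_eq_sum_irred (d n p N : ℕ) (hn : 1 ≤ n) (hd : 2 * n ≤ p + d) (hN : n ≤ N) :
    cleanGF p n = ∑ k ∈ Icc 1 N,
      cleanGF (2 * k) k * coeff n (X ^ k * diagramSeries ^ (2 * k - p)) := by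
  induction d generalizing n p with
  | zero =>
    rw [cleanGF_of_le (by omega), Finset.sum_eq_single n]
    · rw [Nat.sub_eq_zero_of_le (by omega), pow_zero, mul_one, coeff_X_pow, if_pos rfl, mul_one]
    · intro k _ hk
      rcases Nat.lt_or_ge n k with h | h
      · rw [coeff_X_pow_mul', if_neg (by omega), mul_zero]
      · rw [Nat.sub_eq_zero_of_le (by omega), pow_zero, mul_one, coeff_X_pow,
          if_neg (Ne.symm hk), mul_zero]
    · intro h
      exact absurd (Finset.mem_Icc.2 ⟨hn, hN⟩) h
  | succ d ih =>
    by_cases hp : 2 * n ≤ p + d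
    · exact ih n p hn hp hN
    rw [cleanGF_eq_sum (by omega)]
    have h1 : ∀ x ∈ HasAntidiagonal.antidiagonal n,
        (if p + 1 ≤ 2 * x.2 then gf x.1 * cleanGF (p + 1) x.2 else 0) =
        ∑ k ∈ Icc 1 N, if p + 1 ≤ 2 * x.2 then cleanGF (2 * k) k * (gf x.1 *
          coeff x.2 (X ^ k * diagramSeries ^ (2 * k - (p + 1)))) else 0 := by
      intro x hx
      rw [HasAntidiagonal.mem_antidiagonal] at hx
      split_ifs with h
      · rw [ih x.2 (p + 1) (by omega) (by omega) (by omega), Finset.mul_sum]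
        exact Finset.sum_congr rfl fun k _ => by ring
      · simp
    rw [Finset.sum_congr rfl h1, Finset.sum_comm]
    refine Finset.sum_congr rfl fun k _ => ?_
    rcases Nat.lt_or_ge p (2 * k) with hk | hk
    · have : 2 * k - p = (2 * k - (p + 1)) + 1 := by omega
      rw [this, pow_succ', mul_left_comm, coeff_mul, Finset.mul_sum]
      refine Finset.sum_congr rfl fun x _ => ?_
      split_ifs with h
      · rw [diagramSeries, coeff_mk]
      · rw [coeff_X_pow_mul', if_neg (by omega), mul_zero, mul_zero]
    · rw [Nat.sub_eq_zero_of_le hk, pow_zero, mul_one, coeff_X_pow, if_neg (by omega), mul_zero]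
      refine Finset.sum_eq_zero fun x _ => ?_
      split_ifs with h
      · rw [Nat.sub_eq_zero_of_le (by omega), pow_zero, mul_one, coeff_X_pow, if_neg (by omega),
          mul_zero, mul_zero]
      · rfl

open PowerSeries in
lemma coeff_diagramSeries (n : ℕ) :
    coeff n diagramSeries = ∑ k ∈ range (n + 1),
      coeff k (1 + irredSeries) * coeff (n - k) (diagramSeries ^ (2 * k)) := by
  rcases Nat.eq_zero_or_pos n with rfl | hn
  · simp [diagramSeries, irredSeries, gf_zero]
  · rw [diagramSeries, coeff_mk, ← diagramSeries, ← cleanGF_zero,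
      cleanGF_eq_sum_irred (2 * n) n 0 n hn (by omega) le_rfl, Finset.range_eq_Ico,
      Finset.sum_eq_sum_Ico_succ_bot (by omega)]
    have : coeff (n - 0) (diagramSeries ^ (2 * 0)) = 0 := by
      rw [mul_zero, pow_zero, coeff_one, if_neg (by omega)]
    rw [this, mul_zero, zero_add]
    refine Finset.sum_congr (by ext; rw [Finset.mem_Icc, Finset.mem_Ico]; omega) fun k hk => ?_
    rw [Finset.mem_Ico] at hk
    rw [coeff_X_pow_mul', if_pos (by omega), map_add, coeff_one, if_neg (by omega), irredSeries,
      coeff_mk, if_neg (by omega), zero_add, Nat.sub_zero]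

open PowerSeries in
/-- The cycle lemma for chord diagrams. -/
lemma natCast_mul_gf (n : ℕ) {K : ℕ} (hK : n < K) :
    (2 * n + 1 : ℕ) * gf n = ∑ j ∈ range K,
      ((2 * n + 1).choose j : Polynomial ℝ) * coeff n (irredSeries ^ j) := by
  have h := natCast_mul_coeff_pow_of_functional_eq coeff_diagramSeries (by simp [irredSeries]) n 1
  rw [pow_one, Nat.cast_one, one_mul, coeff_one_add_pow _ (by simp [irredSeries]) _ hK] at h
  rw [← h, diagramSeries, coeff_mk]

lemma cleanGF_coeff_nonneg (p n m : ℕ) : 0 ≤ (cleanGF p n).coeff m := by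
  rw [cleanGF, Polynomial.finsetSum_coeff]
  refine Finset.sum_nonneg fun D _ => ?_
  split_ifs
  · rw [Polynomial.coeff_X_pow]
    split_ifs <;> simp
  · simp

lemma coeff_mul_nonneg {P Q : Polynomial ℝ} (hP : ∀ m, 0 ≤ P.coeff m) (hQ : ∀ m, 0 ≤ Q.coeff m)
    (m : ℕ) : 0 ≤ (P * Q).coeff m := by
  rw [Polynomial.coeff_mul]
  exact Finset.sum_nonneg fun x _ => mul_nonneg (hP _) (hQ _)

lemma coeff_irredSeries_pow_nonneg (j n m : ℕ) :
    0 ≤ (PowerSeries.coeff n (irredSeries ^ j)).coeff m := by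
  induction j generalizing n m with
  | zero =>
    rw [pow_zero, PowerSeries.coeff_one]
    split_ifs
    · rw [Polynomial.coeff_one]
      split_ifs <;> simp
    · simp
  | succ j ih =>
    rw [pow_succ', PowerSeries.coeff_mul, Polynomial.finsetSum_coeff]
    refine Finset.sum_nonneg fun x _ => coeff_mul_nonneg (fun m => ?_) (ih _) m
    rw [irredSeries, PowerSeries.coeff_mk]
    split_ifs
    · simp
    · exact cleanGF_coeff_nonneg _ _ _

lemma coeff_irredSeries_pow_eq_zero {j n : ℕ} (h : n < j) :
    PowerSeries.coeff n (irredSeries ^ j) = 0 :=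
  PowerSeries.X_pow_dvd_iff.1
    (pow_dvd_pow_of_dvd (PowerSeries.X_dvd_iff.2 (by simp [irredSeries])) j) n h

/-! ### Comparing concatenations with all diagrams. -/

/-- A bound for the number of concatenations, from a bound for hypergeometric weights. -/
lemma sum_coeff_gf_mul_gf_le {A : ℕ} (hA : 1 ≤ A) (w : ℕ → ℝ) (hw : ∀ j, 0 ≤ w j) {B : ℝ}
    (hB : ∀ n, ∑ j ∈ range n, w j ≤ B) (n m : ℕ)
    (H : ∀ k j i, A ≤ k → 2 * k ≤ n → 1 ≤ j → j ≤ k → i ≤ n - k →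
      ((n : ℝ) + 1) * ((2 * k + 1).choose j * (2 * (n - k) + 1).choose i) ≤
        w j * (2 * n + 1).choose (i + j) * ((2 * k + 1 : ℕ) * (2 * (n - k) + 1 : ℕ))) :
    ∑ k ∈ Icc A (n / 2), (gf k * gf (n - k)).coeff m ≤ 2 * B * (gf n).coeff m := by
  set ψ : ℕ → ℕ → Polynomial ℝ := fun j k => PowerSeries.coeff k (irredSeries ^ j) with hψ
  set u : ℕ → ℕ → ℕ → ℝ := fun j i k => (ψ j k * ψ i (n - k)).coeff m with hu
  set g : ℕ → ℝ := fun J => (2 * n + 1).choose J * (ψ J n).coeff m with hg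
  have hu0 : ∀ j i k, 0 ≤ u j i k := fun j i k =>
    coeff_mul_nonneg (coeff_irredSeries_pow_nonneg _ _) (coeff_irredSeries_pow_nonneg _ _) m
  have hg0 : ∀ J, 0 ≤ g J := fun J =>
    mul_nonneg (Nat.cast_nonneg _) (coeff_irredSeries_pow_nonneg _ _ _)
  have hn0 : (0 : ℝ) < n + 1 := by positivity
  -- The terms with `J > n` vanish; the longer range accommodates every `i + j` with `i, j ≤ n`.
  have hgn : ∑ J ∈ range (2 * n + 1), g J = (2 * n + 1) * (gf n).coeff m := by
    have := congrArg (fun P => Polynomial.coeff P m)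
      (natCast_mul_gf n (show n < 2 * n + 1 by omega))
    simp only [Polynomial.finsetSum_coeff, Polynomial.coeff_natCast_mul] at this
    push_cast at this
    exact this.symm
  have hgf0 : 0 ≤ (gf n).coeff m := by
    rw [← cleanGF_zero]
    exact cleanGF_coeff_nonneg _ _ _
  have hterm : ∀ k ∈ Icc A (n / 2), ((n : ℝ) + 1) * (gf k * gf (n - k)).coeff m ≤
      ∑ j ∈ range (n + 1), ∑ i ∈ range (n + 1),
        w j * (2 * n + 1).choose (i + j) * u j i k := by
    intro k hk
    rw [Finset.mem_Icc] at hk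
    have hk2 : 2 * k ≤ n := by omega
    have e1 := natCast_mul_gf k (show k < n + 1 by omega)
    have e2 := natCast_mul_gf (n - k) (show n - k < n + 1 by omega)
    have e3 : ((2 * k + 1 : ℕ) * (2 * (n - k) + 1 : ℕ) : ℝ) * (gf k * gf (n - k)).coeff m =
        ∑ j ∈ range (n + 1), ∑ i ∈ range (n + 1),
          ((2 * k + 1).choose j * (2 * (n - k) + 1).choose i : ℝ) * u j i k := by
      have e4 : ((2 * k + 1 : ℕ) * gf k) * ((2 * (n - k) + 1 : ℕ) * gf (n - k)) =
          ((2 * k + 1 : ℕ) * ((2 * (n - k) + 1 : ℕ) * (gf k * gf (n - k)))) := by ring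
      rw [e1, e2, Finset.sum_mul_sum] at e4
      have e5 := congrArg (fun P => Polynomial.coeff P m) e4
      simp only [Polynomial.finsetSum_coeff, Polynomial.coeff_natCast_mul] at e5
      rw [mul_assoc, ← e5]
      refine Finset.sum_congr rfl fun j _ => Finset.sum_congr rfl fun i _ => ?_
      rw [mul_mul_mul_comm, mul_assoc, Polynomial.coeff_natCast_mul, Polynomial.coeff_natCast_mul,
        mul_assoc]
    have hpos : (0 : ℝ) < (2 * k + 1 : ℕ) * (2 * (n - k) + 1 : ℕ) := by positivity
    refine le_of_mul_le_mul_left ?_ hpos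
    rw [mul_left_comm, e3, Finset.mul_sum, Finset.mul_sum]
    refine Finset.sum_le_sum fun j _ => ?_
    rw [Finset.mul_sum, Finset.mul_sum]
    refine Finset.sum_le_sum fun i _ => ?_
    by_cases hji : 1 ≤ j ∧ j ≤ k ∧ i ≤ n - k
    · have := mul_le_mul_of_nonneg_right (H k j i hk.1 hk2 hji.1 hji.2.1 hji.2.2) (hu0 j i k)
      linarith
    · have : u j i k = 0 := by
        rw [not_and_or, not_and_or] at hji
        simp only [hu]
        rcases hji with h | h | h
        · obtain rfl : j = 0 := by omega
          have : ψ 0 k = 0 := by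
            simp only [hψ]
            rw [pow_zero, PowerSeries.coeff_one, if_neg (by omega)]
          rw [this, zero_mul, Polynomial.coeff_zero]
        · have : ψ j k = 0 := coeff_irredSeries_pow_eq_zero (by omega)
          rw [this, zero_mul, Polynomial.coeff_zero]
        · have : ψ i (n - k) = 0 := coeff_irredSeries_pow_eq_zero (by omega)
          rw [this, mul_zero, Polynomial.coeff_zero]
      rw [this]
      simp
  have hk : ∀ j i, ∑ k ∈ Icc A (n / 2), u j i k ≤ (ψ (i + j) n).coeff m := by
    intro j i
    have : (ψ (i + j) n).coeff m = ∑ k ∈ range (n + 1), u j i k := by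
      simp only [hψ, hu]
      rw [add_comm i j, pow_add, PowerSeries.coeff_mul, Polynomial.finsetSum_coeff,
        Finset.Nat.sum_antidiagonal_eq_sum_range_succ_mk]
    rw [this]
    refine Finset.sum_le_sum_of_subset_of_nonneg (fun k hk => ?_) (fun k _ _ => hu0 j i k)
    rw [Finset.mem_Icc] at hk
    rw [Finset.mem_range]
    omega
  have hsum : ((n : ℝ) + 1) * ∑ k ∈ Icc A (n / 2), (gf k * gf (n - k)).coeff m ≤
      B * ((2 * n + 1) * (gf n).coeff m) := by
    rw [Finset.mul_sum]
    calc _ ≤ ∑ k ∈ Icc A (n / 2), ∑ j ∈ range (n + 1), ∑ i ∈ range (n + 1),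
          w j * (2 * n + 1).choose (i + j) * u j i k := Finset.sum_le_sum hterm
      _ = ∑ j ∈ range (n + 1), ∑ i ∈ range (n + 1), ∑ k ∈ Icc A (n / 2),
          w j * (2 * n + 1).choose (i + j) * u j i k := by
        rw [Finset.sum_comm]
        exact Finset.sum_congr rfl fun j _ => Finset.sum_comm
      _ ≤ ∑ j ∈ range (n + 1), ∑ i ∈ range (n + 1), w j * g (i + j) := by
        refine Finset.sum_le_sum fun j _ => Finset.sum_le_sum fun i _ => ?_
        rw [← Finset.mul_sum, mul_assoc]
        exact mul_le_mul_of_nonneg_left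
          (mul_le_mul_of_nonneg_left (hk j i) (Nat.cast_nonneg _)) (hw j)
      _ ≤ ∑ j ∈ range (n + 1), w j * ((2 * n + 1) * (gf n).coeff m) := by
        refine Finset.sum_le_sum fun j hj => ?_
        rw [← Finset.mul_sum, ← hgn]
        refine mul_le_mul_of_nonneg_left ?_ (hw j)
        rw [← Finset.sum_image (f := g) (g := fun i => i + j) (by intro x _ y _; simp)]
        refine Finset.sum_le_sum_of_subset_of_nonneg (fun x hx => ?_) (fun x _ _ => hg0 x)
        simp only [Finset.mem_image, Finset.mem_range] at hx hj ⊢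
        omega
      _ = (∑ j ∈ range (n + 1), w j) * ((2 * n + 1) * (gf n).coeff m) := by
        rw [Finset.sum_mul]
      _ ≤ _ := mul_le_mul_of_nonneg_right (hB _) (by positivity)
  have hB0 : 0 ≤ B := by simpa using hB 0
  -- The factor 2 in the conclusion comes from `2n + 1 ≤ 2(n + 1)`.
  refine le_of_mul_le_mul_left (hsum.trans ?_) hn0
  have := mul_nonneg hB0 hgf0
  linarith

end ChordDiagram

/-- The constant 16 collects 2 from the point probability, 2 from replacing `2n + 2` by `2n + 1` in
the binomial coefficient, and 4 from `√j ≤ 4(T + 1)`. Writing `k ≥ A^(1/4) j^(3/4)` leaves a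
summable power of `j` and a decaying power of `A`. -/
lemma succ_mul_choose_mul_choose_le_weight {A n k j i : ℕ} (hA : 1 ≤ A) (hAk : A ≤ k)
    (hk : 2 * k ≤ n) (hj : 1 ≤ j) (hjk : j ≤ k) (hi : i ≤ n - k) :
    ((n : ℝ) + 1) * ((2 * k + 1).choose j * (2 * (n - k) + 1).choose i) ≤
      (16 * (A : ℝ) ^ (-(1 / 4) : ℝ) * (j : ℝ) ^ (-(5 / 4) : ℝ)) * (2 * n + 1).choose (i + j) *
        ((2 * k + 1 : ℕ) * (2 * (n - k) + 1 : ℕ)) := by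
  set T := Nat.sqrt (j / 10) with hT
  have hT1 : 10 * T ^ 2 ≤ j := by
    have := Nat.sqrt_le' (j / 10)
    rw [← hT] at this
    omega
  have hT2 : j < 10 * (T + 1) ^ 2 := by
    have := Nat.lt_succ_sqrt' (j / 10)
    rw [Nat.succ_eq_add_one, ← hT] at this
    omega
  have h1 := succ_mul_choose_mul_choose_le (a := 2 * k + 1) (b := 2 * (n - k) + 1) (i := i) hj
    (by omega) (by omega) (by omega) hT1
  rw [show 2 * k + 1 + (2 * (n - k) + 1) = (2 * n + 1) + 1 by omega] at h1
  have h2 : ((2 * n + 1 + 1).choose (i + j) : ℝ) ≤ 2 * (2 * n + 1).choose (i + j) := by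
    have h3 := Nat.choose_mul_succ_eq (2 * n + 1) (i + j)
    have h4 : (2 * n + 1 + 1).choose (i + j) * (n + 1) ≤
        (2 * (2 * n + 1).choose (i + j)) * (n + 1) := by
      calc _ ≤ (2 * n + 1 + 1).choose (i + j) * (2 * n + 1 + 1 - (i + j)) :=
            Nat.mul_le_mul_left _ (by omega)
        _ = _ := by rw [← h3]; ring
    exact_mod_cast Nat.le_of_mul_le_mul_right h4 (Nat.succ_pos n)
  set c := ((2 * k + 1).choose j * (2 * (n - k) + 1).choose i : ℝ) with hc
  set d := ((2 * n + 1).choose (i + j) : ℝ) with hd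
  have hc0 : 0 ≤ c := by positivity
  have hd0 : 0 ≤ d := by positivity
  have hj0 : (0 : ℝ) < j := by exact_mod_cast hj
  have hA0 : (0 : ℝ) < A := by exact_mod_cast hA
  have hk0 : (0 : ℝ) < k := by exact_mod_cast (by omega : 0 < k)
  have h4 : (j : ℝ) ^ (1 / 2 : ℝ) ≤ 4 * (T + 1) := by
    rw [← Real.sqrt_eq_rpow]
    refine Real.sqrt_le_iff.2 ⟨by positivity, ?_⟩
    have : (j : ℝ) < 10 * (T + 1) ^ 2 := by exact_mod_cast hT2
    nlinarith
  have h5 : (A : ℝ) ^ (1 / 4 : ℝ) * (j : ℝ) ^ (3 / 4 : ℝ) ≤ k := by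
    calc (A : ℝ) ^ (1 / 4 : ℝ) * (j : ℝ) ^ (3 / 4 : ℝ)
        ≤ (k : ℝ) ^ (1 / 4 : ℝ) * (k : ℝ) ^ (3 / 4 : ℝ) := by gcongr
      _ = k := by rw [← Real.rpow_add hk0]; norm_num
  have h6 : (j : ℝ) ^ (1 / 2 : ℝ) * c ≤ 16 * d := by
    calc _ ≤ 4 * (T + 1) * c := mul_le_mul_of_nonneg_right h4 hc0
      _ ≤ 16 * d := by linarith
  have h7 : c ≤ 16 * (A : ℝ) ^ (-(1 / 4) : ℝ) * (j : ℝ) ^ (-(5 / 4) : ℝ) * d * k := by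
    have hq : (0 : ℝ) < (A : ℝ) ^ (1 / 4 : ℝ) * (j : ℝ) ^ (5 / 4 : ℝ) := by positivity
    rw [Real.rpow_neg hA0.le, Real.rpow_neg hj0.le]
    refine le_of_mul_le_mul_left ?_ hq
    calc (A : ℝ) ^ (1 / 4 : ℝ) * (j : ℝ) ^ (5 / 4 : ℝ) * c
        = ((A : ℝ) ^ (1 / 4 : ℝ) * (j : ℝ) ^ (3 / 4 : ℝ)) * ((j : ℝ) ^ (1 / 2 : ℝ) * c) := by
          rw [show (5 / 4 : ℝ) = 3 / 4 + 1 / 2 by norm_num, Real.rpow_add hj0]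
          ring
      _ ≤ k * (16 * d) := mul_le_mul h5 h6 (by positivity) hk0.le
      _ = _ := by
          have : (A : ℝ) ^ (1 / 4 : ℝ) ≠ 0 := by positivity
          have : (j : ℝ) ^ (5 / 4 : ℝ) ≠ 0 := by positivity
          field_simp
  set w := 16 * (A : ℝ) ^ (-(1 / 4) : ℝ) * (j : ℝ) ^ (-(5 / 4) : ℝ) with hw
  have hw0 : 0 ≤ w := by positivity
  have h8 : ((n : ℝ) + 1) ≤ (2 * (n - k) + 1 : ℕ) := by
    exact_mod_cast (by omega : n + 1 ≤ 2 * (n - k) + 1)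
  have h9 : (k : ℝ) ≤ (2 * k + 1 : ℕ) := by exact_mod_cast (by omega : k ≤ 2 * k + 1)
  calc ((n : ℝ) + 1) * c ≤ (2 * (n - k) + 1 : ℕ) * (w * d * (2 * k + 1 : ℕ)) := by
        refine mul_le_mul h8 (h7.trans ?_) hc0 (Nat.cast_nonneg _)
        exact mul_le_mul_of_nonneg_left h9 (by positivity)
    _ = _ := by ring

/-! ### From coefficients to probabilities. -/

namespace ChordDiagram

open Finset

open scoped Classical in
lemma card_closed {n k : ℕ} (hk : k ≤ n) (m : ℕ) :
    ((univ.filter fun D : ChordDiagram n => D.Closed 0 (2 * k) ∧ D.crossings = m).card : ℝ) =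
      (gf k * gf (n - k)).coeff m := by
  rw [← sum_isCut hk, Polynomial.finsetSum_coeff, Finset.card_filter]
  push_cast
  refine Finset.sum_congr rfl fun D _ => ?_
  by_cases h : D.Closed 0 (2 * k)
  · simp only [h, true_and, if_true, Polynomial.coeff_X_pow, eq_comm]
  · simp [h]

lemma card_crossings (n m : ℕ) :
    ((univ.filter fun D : ChordDiagram n => D.crossings = m).card : ℝ) = (gf n).coeff m := by
  rw [gf, Polynomial.finsetSum_coeff, Finset.card_filter]
  push_cast
  refine Finset.sum_congr rfl fun D _ => ?_
  simp only [Polynomial.coeff_X_pow, eq_comm]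

lemma exists_closed_of_le_maxCut {n A : ℕ} (hA : 1 ≤ A) {D : ChordDiagram n}
    (h : A ≤ D.maxCut) :
    ∃ k ∈ Icc A (n / 2), D.Closed 0 (2 * k) ∨ D.Closed 0 (2 * (n - k)) := by
  rw [maxCut, Finset.le_sup_iff (show ⊥ < A from hA)] at h
  obtain ⟨k, hk, hAk⟩ := h
  have hcut : D.IsCut k := (Finset.mem_filter.1 hk).2
  have hkn := hcut.2.1
  have hc : D.Closed 0 (2 * k) := fun i _ hi => ⟨Nat.zero_le _, (hcut.2.2 i).1 hi⟩
  rw [le_min_iff] at hAk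
  rcases le_or_gt k (n / 2) with h' | h'
  · exact ⟨k, Finset.mem_Icc.2 ⟨hAk.1, h'⟩, Or.inl hc⟩
  · refine ⟨n - k, Finset.mem_Icc.2 ⟨hAk.2, by omega⟩, Or.inr ?_⟩
    rwa [Nat.sub_sub_self hkn.le]

/-- A union bound over the size `k` of the smaller side; the factor 2 is for its lying on the left
or on the right. -/
lemma card_le_maxCut {n A : ℕ} (hA : 1 ≤ A) (m : ℕ) :
    ((univ.filter fun D : ChordDiagram n => D.crossings = m ∧ A ≤ D.maxCut).card : ℝ) ≤
      2 * ∑ k ∈ Icc A (n / 2), (gf k * gf (n - k)).coeff m := by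
  classical
  let S : ℕ → Finset (ChordDiagram n) := fun k =>
    univ.filter fun D => D.Closed 0 (2 * k) ∧ D.crossings = m
  have hsub : (univ.filter fun D : ChordDiagram n => D.crossings = m ∧ A ≤ D.maxCut) ⊆
      (Icc A (n / 2)).biUnion fun k => S k ∪ S (n - k) := by
    intro D hD
    simp only [mem_filter, mem_univ, true_and] at hD
    obtain ⟨k, hk, hc⟩ := exists_closed_of_le_maxCut hA hD.2
    simp only [mem_biUnion, mem_union, S, mem_filter, mem_univ, true_and]
    exact ⟨k, hk, hc.imp (fun h => ⟨h, hD.1⟩) (fun h => ⟨h, hD.1⟩)⟩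
  have h1 : (univ.filter fun D : ChordDiagram n => D.crossings = m ∧ A ≤ D.maxCut).card ≤
      ∑ k ∈ Icc A (n / 2), ((S k).card + (S (n - k)).card) :=
    (Finset.card_le_card hsub).trans <| Finset.card_biUnion_le.trans <|
      Finset.sum_le_sum fun k _ => Finset.card_union_le _ _
  refine (Nat.cast_le.2 h1).trans (le_of_eq ?_)
  push_cast
  rw [Finset.mul_sum]
  refine Finset.sum_congr rfl fun k hk => ?_
  rw [Finset.mem_Icc] at hk
  have hkn : k ≤ n := by omega
  simp only [S]
  rw [card_closed hkn, card_closed (Nat.sub_le n k), Nat.sub_sub_self hkn, mul_comm (gf (n - k))]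
  ring

lemma card_le_maxCut_le {A : ℕ} (hA : 1 ≤ A) (n m : ℕ) :
    ((univ.filter fun D : ChordDiagram n => D.crossings = m ∧ A ≤ D.maxCut).card : ℝ) ≤
      64 * (∑' j : ℕ, (j : ℝ) ^ (-(5 / 4) : ℝ)) * (A : ℝ) ^ (-(1 / 4) : ℝ) *
        (univ.filter fun D : ChordDiagram n => D.crossings = m).card := by
  have hs : Summable fun j : ℕ => (j : ℝ) ^ (-(5 / 4) : ℝ) :=
    Real.summable_nat_rpow.2 (by norm_num)
  have h := sum_coeff_gf_mul_gf_le hA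
    (fun j => 16 * (A : ℝ) ^ (-(1 / 4) : ℝ) * (j : ℝ) ^ (-(5 / 4) : ℝ)) (fun j => by positivity)
    (B := 16 * (A : ℝ) ^ (-(1 / 4) : ℝ) * ∑' j : ℕ, (j : ℝ) ^ (-(5 / 4) : ℝ))
    (fun n => by
      rw [← Finset.mul_sum]
      exact mul_le_mul_of_nonneg_left (hs.sum_le_tsum _ fun j _ => by positivity) (by positivity))
    n m
    (fun k j i h1 h2 h3 h4 h5 => succ_mul_choose_mul_choose_le_weight hA h1 h2 h3 h4 h5)
  rw [card_crossings]
  linarith [card_le_maxCut (n := n) hA m]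

lemma uniformDiagram_le {n m : ℕ} (P : ChordDiagram n → Prop) [DecidablePred P] {ε : ℝ}
    (h : ((univ.filter fun D : ChordDiagram n => D.crossings = m ∧ P D).card : ℝ) ≤
      ε * (univ.filter fun D : ChordDiagram n => D.crossings = m).card) :
    uniformDiagram n m {D | P D} ≤ ENNReal.ofReal ε := by
  have e1 : {D : ChordDiagram n | D.crossings = m} =
      ((univ.filter fun D : ChordDiagram n => D.crossings = m : Finset _) : Set _) := by
    ext; simp
  have e2 : {D : ChordDiagram n | D.crossings = m} ∩ {D | P D} =
      ((univ.filter fun D : ChordDiagram n => D.crossings = m ∧ P D : Finset _) : Set _) := by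
    ext; simp
  rw [uniformDiagram, uniformOn, cond_apply (Set.toFinite _).measurableSet, e2, e1,
    Measure.count_apply_finset, Measure.count_apply_finset, mul_comm, ← div_eq_mul_inv]
  -- This also covers the case of no diagram with `m` crossings, where the quotient is `0 / 0 = 0`.
  refine ENNReal.div_le_of_le_mul ?_
  rw [← ENNReal.ofReal_natCast, ← ENNReal.ofReal_natCast,
    ← ENNReal.ofReal_mul' (Nat.cast_nonneg _)]
  exact ENNReal.ofReal_le_ofReal h

end ChordDiagram

theorem mainTheorem11 (C : ℝ) (ε : ℝ) (hε : 0 < ε) :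
    ∃ A : ℕ, ∀ n m : ℕ, m ≤ n.choose 2 → (m : ℝ) ≤ C * n →
      uniformDiagram n m {D : ChordDiagram n | A ≤ D.maxCut} ≤ ENNReal.ofReal ε := by
  have hlim : Filter.Tendsto (fun A : ℕ => 64 * (∑' j : ℕ, (j : ℝ) ^ (-(5 / 4) : ℝ)) *
      (A : ℝ) ^ (-(1 / 4) : ℝ)) Filter.atTop (nhds 0) := by
    have := ((tendsto_rpow_neg_atTop (show (0 : ℝ) < 1 / 4 by norm_num)).comp
      tendsto_natCast_atTop_atTop).const_mul (64 * (∑' j : ℕ, (j : ℝ) ^ (-(5 / 4) : ℝ)))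
    rwa [mul_zero] at this
  obtain ⟨A, hA, hA1⟩ :=
    ((hlim.eventually (gt_mem_nhds hε)).and (Filter.eventually_ge_atTop 1)).exists
  refine ⟨A, fun n m _ _ => ChordDiagram.uniformDiagram_le _ ?_⟩
  exact (ChordDiagram.card_le_maxCut_le hA1 n m).trans
    (mul_le_mul_of_nonneg_right hA.le (Nat.cast_nonneg _))
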